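/- Let $D \ge 0$, $\Delta > 0$ and $\theta$ be real numbers with $-\frac{\pi}{2} \le \theta-\Delta < \theta+\Delta \le \frac{\pi}{2}$. For $M \ge 1$ let ${\bf R}_M$ be the $M\times M$ channel covariance matrix of a uniform linear array of $M$ antennas with element spacing $\lambda D$ ($\lambda$ the carrier wavelength), for a user with angle of arrival $\theta$ and angular spread $\Delta$, that is, the Hermitian Toeplitz matrix $$[{\bf R}_M]_{m,p} = \frac{1}{2\Delta}\int_{\theta-\Delta}^{\theta+\Delta} e^{-j2\pi D(m-p)\sin\alpha}\,d\alpha, \qquad m,p\in\{0,\dots,M-1\}.$$ Let $F^{(M)}(x) = \frac1M \#\{m : \lambda_m({\bf R}_M)\le x\}$ be the empirical CDF of its eigenvalues, counted with multiplicity. Then there is an asymptotic eigenvalue CDF $F$ (a non-decreasing, right-continuous function from $\mathbb{R}$ to $[0,1]$ with limits $0$ at $-\infty$ and $1$ at $+\infty$) such that $F^{(M)}(x)\to F(x)$ as $M\to\infty$ at every continuity point $x$ of $F$, and the asymptotic normalized rank $\rho$ of the covariance, defined by the condition that the jump of $F$ at $0$ (the asymptotic fraction of zero eigenvalues) has height $1-\rho$,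 is $$\rho = \min\{1, \; |D\sin(\theta-\Delta) - D\sin(\theta+\Delta)|\}.$$ -/

import Mathlib

open Filter Topology

/-- The channel covariance matrix of a uniform linear array of `M` antennas with element spacing
`λ D` (`λ` the carrier wavelength), for a user with angle of arrival `θ` and angular spread `Δ`:
`R (m, p) = (1 / 2Δ) ∫_{θ - Δ}^{θ + Δ} exp (-j 2π D (m - p) sin α) dα`, `0 ≤ m, p ≤ M - 1`. -/
noncomputable def ulaCovariance (D θ Δ : ℝ) (M : ℕ) : Matrix (Fin M) (Fin M) ℂ :=
  Matrix.of fun m p =>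
    (1 / (2 * (Δ : ℂ))) * ∫ α in (-Δ + θ)..(Δ + θ),
      Complex.exp (-Complex.I * 2 * Real.pi * D * (((m : ℕ) : ℂ) - ((p : ℕ) : ℂ)) * Real.sin α)

theorem ulaCovariance_isHermitian (D θ Δ : ℝ) (M : ℕ) : (ulaCovariance D θ Δ M).IsHermitian := by
  ext m p
  simp only [ulaCovariance, Matrix.conjTranspose_apply, Matrix.of_apply, star_mul',
    RCLike.star_def, ← intervalIntegral.intervalIntegral_conj, ← Complex.exp_conj]
  simp only [map_mul, map_sub, map_neg, map_div₀, map_one, map_ofNat, map_natCast,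
    Complex.conj_I, Complex.conj_ofReal]
  congr 2
  ext α
  congr 1
  ring

/-- The empirical cumulative distribution function of the eigenvalues (counted with multiplicity)
of an `M × M` Hermitian matrix: the fraction of eigenvalues that are at most `x`. -/
noncomputable def empiricalEigenvalueCDF {M : ℕ} {A : Matrix (Fin M) (Fin M) ℂ}
    (hA : A.IsHermitian) (x : ℝ) : ℝ :=
  ((Finset.univ.filter fun m : Fin M => hA.eigenvalues m ≤ x).card : ℝ) / M

/-- `F` is the asymptotic eigenvalue CDF of the sequence of Hermitian matrices `A M`: a cumulative
distribution function (non-decreasing, right-continuous, from `0` to `1`) to which the empirical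
eigenvalue CDFs converge, as `M → ∞`, at every point of continuity of `F`. -/
structure IsAsymptoticEigenvalueCDF (A : ∀ M : ℕ, Matrix (Fin M) (Fin M) ℂ)
    (hA : ∀ M, (A M).IsHermitian) (F : ℝ → ℝ) : Prop where
  mono : Monotone F
  right_continuous : ∀ x, ContinuousWithinAt F (Set.Ici x) x
  tendsto_atBot : Tendsto F atBot (𝓝 0)
  tendsto_atTop : Tendsto F atTop (𝓝 1)
  tendsto_empirical : ∀ x, ContinuousAt F x →
    Tendsto (fun M : ℕ => empiricalEigenvalueCDF (hA M) x) atTop (𝓝 (F x))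

/-- The sequence of Hermitian matrices `A M` has asymptotic normalized rank `ρ`: the asymptotic
eigenvalue CDF exists, and its jump at `0`, which is the asymptotic fraction of zero eigenvalues,
has height `1 - ρ`. -/
def HasAsymptoticNormalizedRank (A : ∀ M : ℕ, Matrix (Fin M) (Fin M) ℂ)
    (hA : ∀ M, (A M).IsHermitian) (ρ : ℝ) : Prop :=
  ∃ F : ℝ → ℝ, IsAsymptoticEigenvalueCDF A hA F ∧ F 0 - Function.leftLim F 0 = 1 - ρ

/-!
For `D > 0` the covariance matrices are the Toeplitz matrices of the angular spectrum `f`: the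
density on the circle `ℝ / ℤ` of the law of `D sin α`, with `α` uniform on the interval of angles of
arrival. By Szegő's theorem their eigenvalue distributions converge to the distribution of `f` under
Haar measure, so the limiting fraction of nonzero eigenvalues is the measure of the arc on which `f`
is positive, `min 1 (D sin (θ + Δ) - D sin (θ - Δ))`. The symbol `f` is integrable but in general
unbounded, and the argument below needs nothing more.

With `e(t)` the steering vector at `t`, the Toeplitz matrix is `∫ f(t) e(t) e(t)ᴴ dt`, and
`∫ e(t) e(t)ᴴ dt` is the identity. This gives the Berezin–Lieb inequalities
`∫ φ(σ_M f) ≤ (1 / M) ∑ φ(λ_m) ≤ ∫ φ(f)` for convex `φ`, where `σ_M f(t) = ⟨e(t), T e(t)⟩ / M` is the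
Fejér mean of `f` (`integral_fejerMean_le_empiricalPrimitive`, `empiricalPrimitive_le_integral`).
Only `φ(x) = (c - x)⁺` is needed. This `φ` is 1-Lipschitz, and `σ_M f → f` in `L¹`
(`tendsto_integral_norm_fejerMean_sub`), so the middle term converges to `∫ (c - f)⁺` for every `c`
(`tendsto_empiricalPrimitive_toeplitz`). As functions of `c`, these quantities are convex primitives
of the CDFs, and convergence of convex primitives gives convergence of the CDFs at the continuity
points of the limit (`hasAsymptoticNormalizedRank_of_tendsto`).

The density exists, and is positive almost everywhere on the arc swept by `D sin α`, because `arcsin`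
and `sin` map null sets to null sets (`measureReal_angularSpectrum_ne_zero`).

For `D = 0` the law of `D sin α` is a point mass and has no density. The covariance matrix is then
the all-ones matrix, of rank one, and all but a vanishing fraction of its eigenvalues are zero
(`tendsto_empiricalPrimitive_ulaCovariance_zero`).
-/

open Filter Topology
open MeasureTheory ProbabilityTheory
open AddCircle

/-! ### From convergence of integrated distribution functions to convergence of the CDFs -/

/-- If `G` is squeezed between difference quotients of `g` (so `g` is a convex primitive of `G`),
and likewise `G' n` for `g' n`, then pointwise convergence of the primitives forces convergence of
the functions at the continuity points of the limit. -/
theorem tendsto_of_tendsto_primitive {G g : ℝ → ℝ} {G' g' : ℕ → ℝ → ℝ}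
    (h : ∀ a b, a < b → (b - a) * G a ≤ g b - g a ∧ g b - g a ≤ (b - a) * G b)
    (h' : ∀ n a b, a < b →
      (b - a) * G' n a ≤ g' n b - g' n a ∧ g' n b - g' n a ≤ (b - a) * G' n b)
    (hg : ∀ c, Tendsto (fun n => g' n c) atTop (𝓝 (g c))) {x : ℝ} (hx : ContinuousAt G x) :
    Tendsto (fun n => G' n x) atTop (𝓝 (G x)) := by
  rw [Metric.tendsto_atTop]
  intro ε hε
  obtain ⟨δ, hδ, hδG⟩ := Metric.continuousAt_iff.1 hx (ε / 2) (by positivity)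
  set η := δ / 2 with hη
  have hη0 : 0 < η := by positivity
  have hr : |G (x + η) - G x| < ε / 2 := hδG (by
    rw [Real.dist_eq, add_sub_cancel_left, abs_of_pos hη0]; linarith)
  have hl : |G (x - η) - G x| < ε / 2 := hδG (by
    rw [Real.dist_eq, show x - η - x = -η by ring, abs_neg, abs_of_pos hη0]; linarith)
  -- The difference quotients over steps of length `η` divide errors of the primitives by `η`.
  have hεη : 0 < ε * η / 8 := by positivity
  obtain ⟨N₁, hN₁⟩ := Metric.tendsto_atTop.1 (hg (x - η)) _ hεη
  obtain ⟨N₂, hN₂⟩ := Metric.tendsto_atTop.1 (hg x) _ hεη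
  obtain ⟨N₃, hN₃⟩ := Metric.tendsto_atTop.1 (hg (x + η)) _ hεη
  refine ⟨max N₁ (max N₂ N₃), fun n hn => ?_⟩
  have e₁ := hN₁ n ((le_max_left _ _).trans hn)
  have e₂ := hN₂ n (((le_max_left _ _).trans (le_max_right _ _)).trans hn)
  have e₃ := hN₃ n (((le_max_right _ _).trans (le_max_right _ _)).trans hn)
  rw [Real.dist_eq, abs_lt] at e₁ e₂ e₃ ⊢
  rw [abs_lt] at hr hl
  have a₁ := (h x (x + η) (by linarith)).2
  have a₂ := (h (x - η) x (by linarith)).1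
  have b₁ := (h' n x (x + η) (by linarith)).1
  have b₂ := (h' n (x - η) x (by linarith)).2
  rw [show x + η - x = η by ring] at a₁ b₁
  rw [show x - (x - η) = η by ring] at a₂ b₂
  constructor
  · have : η * (G x - G' n x) < η * ε := by nlinarith
    nlinarith [lt_of_mul_lt_mul_left this hη0.le]
  · have : η * (G' n x - G x) < η * ε := by nlinarith
    nlinarith [lt_of_mul_lt_mul_left this hη0.le]

/-- Pointwise source of the squeeze: `y ↦ (y - l)⁺` is a convex primitive of `y ↦ 1_{l ≤ y}`. -/
theorem indicator_le_posPart_sub {a b : ℝ} (hab : a < b) (l : ℝ) :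
    (b - a) * (if l ≤ a then 1 else 0) ≤ max (b - l) 0 - max (a - l) 0 ∧
      max (b - l) 0 - max (a - l) 0 ≤ (b - a) * (if l ≤ b then 1 else 0) := by
  split_ifs with h₁ h₂ h₂
  · rw [max_eq_left (by linarith), max_eq_left (by linarith)]; constructor <;> linarith
  · exact absurd (h₁.trans hab.le) h₂
  · rw [max_eq_left (by linarith), max_eq_right (by linarith)]; constructor <;> linarith
  · rw [max_eq_right (by linarith), max_eq_right (by linarith)]; simp

/-- The integrated empirical eigenvalue CDF: the normalized sum of `(c - λ)⁺` over the
eigenvalues `λ`. -/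
noncomputable def empiricalPrimitive {M : ℕ} {A : Matrix (Fin M) (Fin M) ℂ}
    (hA : A.IsHermitian) (c : ℝ) : ℝ :=
  (∑ m, max (c - hA.eigenvalues m) 0) / M

theorem empiricalPrimitive_squeeze {M : ℕ} {A : Matrix (Fin M) (Fin M) ℂ} (hA : A.IsHermitian)
    {a b : ℝ} (hab : a < b) :
    (b - a) * empiricalEigenvalueCDF hA a ≤ empiricalPrimitive hA b - empiricalPrimitive hA a ∧
      empiricalPrimitive hA b - empiricalPrimitive hA a ≤
        (b - a) * empiricalEigenvalueCDF hA b := by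
  have hcard (x : ℝ) : ((Finset.univ.filter fun m : Fin M => hA.eigenvalues m ≤ x).card : ℝ) =
      ∑ m, if hA.eigenvalues m ≤ x then (1 : ℝ) else 0 := by
    rw [Finset.sum_boole]
  simp only [empiricalEigenvalueCDF, empiricalPrimitive, hcard]
  rw [← sub_div, ← Finset.sum_sub_distrib, ← mul_div_assoc, ← mul_div_assoc, Finset.mul_sum,
    Finset.mul_sum]
  exact ⟨div_le_div_of_nonneg_right
    (Finset.sum_le_sum fun m _ => (indicator_le_posPart_sub hab _).1) (Nat.cast_nonneg _),
    div_le_div_of_nonneg_right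
    (Finset.sum_le_sum fun m _ => (indicator_le_posPart_sub hab _).2) (Nat.cast_nonneg _)⟩

theorem integrable_posPart_sub {Ω : Type*} [MeasurableSpace Ω] {μ : Measure Ω}
    [IsFiniteMeasure μ] {f : Ω → ℝ} (hf : Integrable f μ) (c : ℝ) :
    Integrable (fun x => max (c - f x) 0) μ :=
  ((integrable_const c).sub hf).pos_part

theorem cdf_map_squeeze {Ω : Type*} [MeasurableSpace Ω] {μ : Measure Ω}
    [IsProbabilityMeasure μ] {f : Ω → ℝ} (hf : Integrable f μ) (hfm : Measurable f)
    {a b : ℝ} (hab : a < b) :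
    (b - a) * cdf (μ.map f) a ≤ (∫ x, max (b - f x) 0 ∂μ) - ∫ x, max (a - f x) 0 ∂μ ∧
      (∫ x, max (b - f x) 0 ∂μ) - ∫ x, max (a - f x) 0 ∂μ ≤ (b - a) * cdf (μ.map f) b := by
  have : IsProbabilityMeasure (μ.map f) := Measure.isProbabilityMeasure_map hfm.aemeasurable
  have hmeas (c : ℝ) : MeasurableSet {x | f x ≤ c} := hfm measurableSet_Iic
  have hcdf (c : ℝ) : cdf (μ.map f) c = ∫ x, (if f x ≤ c then (1 : ℝ) else 0) ∂μ := by
    rw [cdf_eq_real, map_measureReal_apply hfm measurableSet_Iic]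
    have : (fun x => if f x ≤ c then (1 : ℝ) else 0) = {x | f x ≤ c}.indicator 1 := by
      ext x; simp [Set.indicator_apply]
    rw [this, integral_indicator_one (hmeas c)]
    rfl
  have hint (c : ℝ) : Integrable (fun x => (b - a) * (if f x ≤ c then (1 : ℝ) else 0)) μ := by
    refine Integrable.const_mul ?_ _
    have : (fun x => if f x ≤ c then (1 : ℝ) else 0) = {x | f x ≤ c}.indicator 1 := by
      ext x; simp [Set.indicator_apply]
    rw [this]
    exact (integrable_const (1 : ℝ)).indicator (hmeas c)
  have hi := (integrable_posPart_sub hf b).sub (integrable_posPart_sub hf a)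
  rw [hcdf, hcdf, ← integral_const_mul, ← integral_const_mul,
    ← integral_sub (integrable_posPart_sub hf b) (integrable_posPart_sub hf a)]
  exact ⟨integral_mono (hint a) hi fun x => (indicator_le_posPart_sub hab _).1,
    integral_mono hi (hint b) fun x => (indicator_le_posPart_sub hab _).2⟩

/-- If the integrated empirical eigenvalue CDFs converge to the integrated CDF of a random variable
`f`, then the sequence has asymptotic normalized rank `ℙ (f ≠ 0)`. -/
theorem hasAsymptoticNormalizedRank_of_tendsto {Ω : Type*} [MeasurableSpace Ω] {μ : Measure Ω}
    [IsProbabilityMeasure μ] {f : Ω → ℝ} (hf : Integrable f μ) (hfm : Measurable f)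
    {A : ∀ M : ℕ, Matrix (Fin M) (Fin M) ℂ} (hA : ∀ M, (A M).IsHermitian)
    (h : ∀ c, Tendsto (fun M => empiricalPrimitive (hA M) c) atTop
      (𝓝 (∫ x, max (c - f x) 0 ∂μ))) :
    HasAsymptoticNormalizedRank A hA (μ.real {x | f x ≠ 0}) := by
  have : IsProbabilityMeasure (μ.map f) := Measure.isProbabilityMeasure_map hfm.aemeasurable
  refine ⟨cdf (μ.map f), ⟨monotone_cdf _, (cdf (μ.map f)).right_continuous, tendsto_cdf_atBot _,
    tendsto_cdf_atTop _, fun x hx => ?_⟩, ?_⟩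
  · exact tendsto_of_tendsto_primitive (fun a b hab => cdf_map_squeeze hf hfm hab)
      (fun M a b hab => empiricalPrimitive_squeeze (hA M) hab) h hx
  · have h0 : (μ.map f).real {0} = cdf (μ.map f) 0 - Function.leftLim (cdf (μ.map f)) 0 := by
      conv_lhs => rw [← measure_cdf (μ.map f)]
      rw [measureReal_def, StieltjesFunction.measure_singleton, ENNReal.toReal_ofReal]
      exact sub_nonneg.2 ((monotone_cdf _).leftLim_le le_rfl)
    rw [← h0, map_measureReal_apply hfm (measurableSet_singleton 0),
      show {x | f x ≠ 0} = (f ⁻¹' {0})ᶜ from rfl,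
      probReal_compl_eq_one_sub (hfm (measurableSet_singleton 0)), sub_sub_cancel]

/-! ### Steering vectors and Fejér means on the circle -/

/-- The steering vector at `x`, with entries `exp (-2πi m x)`, `0 ≤ m < M`. The sign is chosen so
that the Toeplitz matrix with entries `fourierCoeff f (m - p)` is the `f`-weighted average of the
rank-one matrices `e eᴴ`, where `e` runs over the steering vectors. -/
noncomputable def steeringVector (M : ℕ) (x : UnitAddCircle) : EuclideanSpace ℂ (Fin M) :=
  WithLp.toLp 2 fun m => fourier (-(m : ℤ)) x

theorem steeringVector_apply (M : ℕ) (x : UnitAddCircle) (m : Fin M) :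
    steeringVector M x m = fourier (-(m : ℤ)) x := rfl

theorem continuous_steeringVector (M : ℕ) : Continuous (steeringVector M) := by
  unfold steeringVector
  fun_prop

theorem norm_fourier_apply (n : ℤ) (x : UnitAddCircle) : ‖fourier n x‖ = 1 := by
  rw [fourier_apply]; exact Circle.norm_coe _

theorem norm_sq_steeringVector (M : ℕ) (x : UnitAddCircle) : ‖steeringVector M x‖ ^ 2 = M := by
  rw [EuclideanSpace.norm_sq_eq]
  simp_rw [steeringVector_apply, norm_fourier_apply]
  simp

theorem integrable_bdd_mul_circle {E : Type*} [NormedAddCommGroup E] [NormedSpace ℝ E]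
    {g : UnitAddCircle → ℝ} (hg : Continuous g) {f : UnitAddCircle → E}
    (hf : Integrable f haarAddCircle) : Integrable (fun x => g x • f x) haarAddCircle := by
  obtain ⟨C, hC⟩ := isCompact_univ.exists_bound_of_continuousOn hg.continuousOn
  exact hf.bdd_smul C hg.aestronglyMeasurable (Eventually.of_forall fun x => hC x trivial)

theorem continuous_norm_sq_inner_steeringVector {M : ℕ} (v : EuclideanSpace ℂ (Fin M)) :
    Continuous fun x => ‖inner ℂ v (steeringVector M x)‖ ^ 2 :=
  ((continuous_const.inner (continuous_steeringVector M)).norm).pow 2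

/-- The Hermitian form of the Toeplitz matrix with symbol `f` at the vector `v` is the integral of
`f` against `|⟨v, e(x)⟩|²`, `e(x)` the steering vector. -/
theorem integral_norm_sq_inner_steeringVector_smul {M : ℕ} (v : EuclideanSpace ℂ (Fin M))
    {f : UnitAddCircle → ℂ} (hf : Integrable f haarAddCircle) :
    ∫ x, (‖inner ℂ v (steeringVector M x)‖ ^ 2) • f x ∂haarAddCircle =
      ∑ m, ∑ p, star (v m) * v p * fourierCoeff f ((m : ℤ) - p) := by
  have hpt (x : UnitAddCircle) : (‖inner ℂ v (steeringVector M x)‖ ^ 2) • f x =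
      ∑ m, ∑ p, star (v m) * v p * (fourier (-((m : ℤ) - p)) x • f x) := by
    have h1 : inner ℂ v (steeringVector M x) = ∑ m, star (v m) * fourier (-(m : ℤ)) x := by
      simp [PiLp.inner_apply, steeringVector_apply, mul_comm]
    have h2 : star (inner ℂ v (steeringVector M x)) = ∑ p, v p * fourier (p : ℤ) x := by
      rw [h1, star_sum]
      refine Finset.sum_congr rfl fun p _ => ?_
      rw [star_mul', star_star, fourier_neg]
      simp
    have h3 : ((‖inner ℂ v (steeringVector M x)‖ ^ 2 : ℝ) : ℂ) =
        inner ℂ v (steeringVector M x) * star (inner ℂ v (steeringVector M x)) := by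
      rw [RCLike.star_def, Complex.mul_conj, Complex.normSq_eq_norm_sq]
    rw [Complex.real_smul, h3, h2, h1, Finset.sum_mul_sum, Finset.sum_mul]
    refine Finset.sum_congr rfl fun m _ => ?_
    rw [Finset.sum_mul]
    refine Finset.sum_congr rfl fun p _ => ?_
    rw [neg_sub, sub_eq_add_neg, fourier_add, smul_eq_mul]
    ring
  have hi (m p : Fin M) : Integrable
      (fun x => star (v m) * v p * (fourier (-((m : ℤ) - p)) x • f x)) haarAddCircle :=
    (hf.fourier_smul _).const_mul _
  simp_rw [hpt]
  rw [integral_finsetSum _ fun m _ => integrable_finsetSum _ fun p _ => hi m p]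
  refine Finset.sum_congr rfl fun m _ => ?_
  rw [integral_finsetSum _ fun p _ => hi m p]
  refine Finset.sum_congr rfl fun p _ => ?_
  rw [integral_const_mul]
  rfl

/-- Resolution of the identity: the steering vectors average to the identity matrix. -/
theorem integral_norm_sq_inner_steeringVector {M : ℕ} (v : EuclideanSpace ℂ (Fin M)) :
    ∫ x, ‖inner ℂ v (steeringVector M x)‖ ^ 2 ∂haarAddCircle = ‖v‖ ^ 2 := by
  have h1 : (fun _ : UnitAddCircle => (1 : ℂ)) = fourier (T := 1) 0 := by ext; simp
  have h := integral_norm_sq_inner_steeringVector_smul v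
    (f := fun _ => 1) (integrable_const _)
  rw [h1, fourierCoeff_fourier] at h
  have h2 : ∀ m p : Fin M, (Pi.single (0 : ℤ) (1 : ℂ) : ℤ → ℂ) ((m : ℤ) - p) =
      if m = p then 1 else 0 := by
    intro m p
    rw [Pi.single_apply]
    congr 1
    rw [sub_eq_zero, Nat.cast_inj, Fin.ext_iff]
  simp only [h2, mul_ite, mul_one, mul_zero, Finset.sum_ite_eq, Finset.mem_univ, if_true,
    Complex.real_smul] at h
  rw [integral_complex_ofReal] at h
  apply Complex.ofReal_injective
  rw [h, EuclideanSpace.norm_sq_eq, Complex.ofReal_sum]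
  refine Finset.sum_congr rfl fun m _ => ?_
  rw [RCLike.star_def, Complex.conj_mul', Complex.ofReal_pow]

/-- The Fejér kernel `|⟨e(t), e(s)⟩|² / M`, in terms of the steering vectors. -/
noncomputable def fejerKernel (M : ℕ) (t s : UnitAddCircle) : ℝ :=
  ‖inner ℂ (steeringVector M t) (steeringVector M s)‖ ^ 2 / M

theorem fejerKernel_nonneg (M : ℕ) (t s : UnitAddCircle) : 0 ≤ fejerKernel M t s := by
  unfold fejerKernel; positivity

theorem fejerKernel_symm (M : ℕ) (t s : UnitAddCircle) :
    fejerKernel M t s = fejerKernel M s t := by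
  unfold fejerKernel; rw [norm_inner_symm]

theorem continuous_fejerKernel (M : ℕ) :
    Continuous fun q : UnitAddCircle × UnitAddCircle => fejerKernel M q.1 q.2 := by
  unfold fejerKernel
  exact (((((continuous_steeringVector M).comp continuous_fst).inner
    ((continuous_steeringVector M).comp continuous_snd)).norm).pow 2).div_const _

theorem continuous_fejerKernel_right (M : ℕ) (t : UnitAddCircle) :
    Continuous (fejerKernel M t) :=
  (continuous_norm_sq_inner_steeringVector _).div_const _

theorem integral_fejerKernel_le_one (M : ℕ) (t : UnitAddCircle) :
    ∫ s, fejerKernel M t s ∂haarAddCircle ≤ 1 := by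
  unfold fejerKernel
  rw [integral_div, integral_norm_sq_inner_steeringVector, norm_sq_steeringVector]
  exact div_self_le_one _

/-- The Fejér mean of order `M` of a function on the circle. -/
noncomputable def fejerMean (M : ℕ) (f : UnitAddCircle → ℂ) (t : UnitAddCircle) : ℂ :=
  ∫ s, fejerKernel M t s • f s ∂haarAddCircle

theorem integrable_fejerKernel_smul_prod (M : ℕ) {E : Type*} [NormedAddCommGroup E]
    [NormedSpace ℝ E] {f : UnitAddCircle → E}
    (hf : Integrable f haarAddCircle) :
    Integrable (fun q : UnitAddCircle × UnitAddCircle => fejerKernel M q.1 q.2 • f q.2)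
      (haarAddCircle.prod haarAddCircle) := by
  obtain ⟨C, hC⟩ := isCompact_univ.exists_bound_of_continuousOn
    (continuous_fejerKernel M).continuousOn
  exact (hf.comp_snd haarAddCircle).bdd_smul C (continuous_fejerKernel M).aestronglyMeasurable
    (Eventually.of_forall fun x => hC x trivial)

theorem integrable_fejerMean (M : ℕ) {f : UnitAddCircle → ℂ} (hf : Integrable f haarAddCircle) :
    Integrable (fejerMean M f) haarAddCircle :=
  (integrable_fejerKernel_smul_prod M hf).integral_prod_left

theorem fejerMean_sub (M : ℕ) {f g : UnitAddCircle → ℂ} (hf : Integrable f haarAddCircle)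
    (hg : Integrable g haarAddCircle) (t : UnitAddCircle) :
    fejerMean M (fun x => f x - g x) t = fejerMean M f t - fejerMean M g t := by
  unfold fejerMean
  simp_rw [smul_sub]
  exact integral_sub (integrable_bdd_mul_circle (continuous_fejerKernel_right M t) hf)
    (integrable_bdd_mul_circle (continuous_fejerKernel_right M t) hg)

theorem fejerMean_add (M : ℕ) {f g : UnitAddCircle → ℂ} (hf : Integrable f haarAddCircle)
    (hg : Integrable g haarAddCircle) (t : UnitAddCircle) :
    fejerMean M (fun x => f x + g x) t = fejerMean M f t + fejerMean M g t := by
  unfold fejerMean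
  simp_rw [smul_add]
  exact integral_add (integrable_bdd_mul_circle (continuous_fejerKernel_right M t) hf)
    (integrable_bdd_mul_circle (continuous_fejerKernel_right M t) hg)

theorem fejerMean_const_mul (M : ℕ) (c : ℂ) (f : UnitAddCircle → ℂ) (t : UnitAddCircle) :
    fejerMean M (fun x => c * f x) t = c * fejerMean M f t := by
  unfold fejerMean
  simp_rw [← mul_smul_comm]
  exact integral_const_mul _ _

/-- Fejér means are contractions of `L¹`. -/
theorem integral_norm_fejerMean_le (M : ℕ) {f : UnitAddCircle → ℂ}
    (hf : Integrable f haarAddCircle) :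
    ∫ t, ‖fejerMean M f t‖ ∂haarAddCircle ≤ ∫ s, ‖f s‖ ∂haarAddCircle := by
  have hprod := integrable_fejerKernel_smul_prod M hf.norm
  calc ∫ t, ‖fejerMean M f t‖ ∂haarAddCircle
      ≤ ∫ t, ∫ s, fejerKernel M t s • ‖f s‖ ∂haarAddCircle ∂haarAddCircle := by
        refine integral_mono (integrable_fejerMean M hf).norm hprod.integral_prod_left fun t => ?_
        refine (norm_integral_le_integral_norm _).trans_eq ?_
        simp_rw [norm_smul, Real.norm_of_nonneg (fejerKernel_nonneg _ _ _), smul_eq_mul]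
    _ = ∫ s, ∫ t, fejerKernel M t s • ‖f s‖ ∂haarAddCircle ∂haarAddCircle :=
        integral_integral_swap hprod
    _ ≤ ∫ s, ‖f s‖ ∂haarAddCircle := by
        refine integral_mono hprod.integral_prod_right hf.norm fun s => ?_
        simp only [smul_eq_mul, integral_mul_const]
        refine mul_le_of_le_one_left (norm_nonneg _) ?_
        simp_rw [fun t => fejerKernel_symm M t s]
        exact integral_fejerKernel_le_one M s

theorem fejerMean_eq_sum (M : ℕ) {f : UnitAddCircle → ℂ} (hf : Integrable f haarAddCircle)
    (t : UnitAddCircle) : fejerMean M f t = (∑ m : Fin M, ∑ p : Fin M,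
      star (steeringVector M t m) * steeringVector M t p * fourierCoeff f ((m : ℤ) - p)) / M := by
  rw [← integral_norm_sq_inner_steeringVector_smul _ hf, ← integral_div]
  unfold fejerMean fejerKernel
  congr with s
  simp only [Complex.real_smul]
  push_cast
  ring

/-- The number of pairs `(m, p)` in `[0, M)²` on the `n`-th diagonal `m - p = n`. -/
noncomputable def diagonalCard (M : ℕ) (n : ℤ) : ℕ :=
  (Finset.univ.filter fun q : Fin M × Fin M => (q.1 : ℤ) - q.2 = n).card

theorem diagonalCard_le (M : ℕ) (n : ℤ) : diagonalCard M n ≤ M := by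
  unfold diagonalCard
  conv_rhs => rw [← Fintype.card_fin M, ← Finset.card_univ]
  refine Finset.card_le_card_of_injOn Prod.fst (fun _ _ => Finset.mem_coe.2 (Finset.mem_univ _)) ?_
  rintro ⟨a, b⟩ h ⟨a', b'⟩ h' (rfl : a = a')
  simp only [Finset.coe_filter, Finset.mem_univ, true_and, Set.mem_ofPred_eq] at h h'
  simp only [Prod.mk.injEq, true_and, Fin.ext_iff]
  omega

theorem le_diagonalCard (M : ℕ) (n : ℤ) : M - n.natAbs ≤ diagonalCard M n := by
  unfold diagonalCard
  conv_lhs => rw [← Fintype.card_fin (M - n.natAbs), ← Finset.card_univ]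
  refine Finset.card_le_card_of_injOn (fun k : Fin (M - n.natAbs) =>
    ((⟨k + n.toNat, by omega⟩ : Fin M), (⟨k + (-n).toNat, by omega⟩ : Fin M))) ?_ ?_
  · intro k _
    simp only [Finset.coe_filter, Finset.mem_univ, true_and, Set.mem_ofPred_eq]
    push_cast
    omega
  · intro k _ k' _ h
    simp only [Prod.mk.injEq, Fin.mk.injEq] at h
    exact Fin.ext (by omega)

theorem tendsto_diagonalCard_div (n : ℤ) :
    Tendsto (fun M : ℕ => (diagonalCard M n : ℝ) / M) atTop (𝓝 1) := by
  have hlow : Tendsto (fun M : ℕ => 1 - (n.natAbs : ℝ) / M) atTop (𝓝 1) := by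
    simpa using tendsto_const_nhds.sub (tendsto_const_div_atTop_nhds_zero_nat (n.natAbs : ℝ))
  refine tendsto_of_tendsto_of_tendsto_of_le_of_le' hlow tendsto_const_nhds ?_ ?_
  · filter_upwards [eventually_gt_atTop 0] with M hM
    have hM' : (0 : ℝ) < M := Nat.cast_pos.2 hM
    rw [le_div_iff₀ hM', sub_mul, one_mul, div_mul_cancel₀ _ hM'.ne', sub_le_iff_le_add]
    exact_mod_cast Nat.sub_le_iff_le_add.1 (le_diagonalCard M n)
  · exact Eventually.of_forall fun M =>
      div_le_one_of_le₀ (Nat.cast_le.2 (diagonalCard_le M n)) (Nat.cast_nonneg _)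

theorem integrable_of_continuousMap_circle (g : C(UnitAddCircle, ℂ)) :
    Integrable g haarAddCircle :=
  g.continuous.integrable_of_hasCompactSupport (HasCompactSupport.of_compactSpace _)

theorem fejerMean_fourier (M : ℕ) (n : ℤ) (t : UnitAddCircle) :
    fejerMean M (fourier n) t = ((diagonalCard M n : ℝ) / M : ℝ) * fourier n t := by
  rw [fejerMean_eq_sum M (integrable_of_continuousMap_circle _), fourierCoeff_fourier]
  have h (m p : Fin M) : star (steeringVector M t m) * steeringVector M t p *
      (Pi.single n (1 : ℂ) : ℤ → ℂ) ((m : ℤ) - p) =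
      if (m : ℤ) - p = n then fourier n t else 0 := by
    rw [Pi.single_apply]
    split_ifs with hmp
    · rw [steeringVector_apply, steeringVector_apply, RCLike.star_def, ← fourier_neg, ← fourier_add,
        neg_neg, mul_one, ← sub_eq_add_neg, hmp]
    · rw [mul_zero]
  simp_rw [h]
  rw [← Fintype.sum_prod_type' (f := fun m p : Fin M =>
    if (m : ℤ) - p = n then (fourier n t : ℂ) else 0), ← Finset.sum_filter, Finset.sum_const,
    nsmul_eq_mul]
  unfold diagonalCard
  push_cast
  ring

theorem tendsto_integral_fejerMean_sub_of_mem_span {g : C(UnitAddCircle, ℂ)}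
    (hg : g ∈ Submodule.span ℂ (Set.range (fourier (T := 1)))) :
    Tendsto (fun M => ∫ t, ‖fejerMean M g t - g t‖ ∂haarAddCircle) atTop (𝓝 0) := by
  induction hg using Submodule.span_induction with
  | mem g h =>
    obtain ⟨n, rfl⟩ := h
    have h (M : ℕ) (t : UnitAddCircle) :
        ‖fejerMean M (fourier n) t - fourier n t‖ = |(diagonalCard M n : ℝ) / M - 1| := by
      rw [fejerMean_fourier, ← sub_one_mul, norm_mul, norm_fourier_apply, mul_one,
        ← Complex.ofReal_one, ← Complex.ofReal_sub, Complex.norm_real, Real.norm_eq_abs]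
    simp_rw [h]
    simpa using ((tendsto_diagonalCard_div n).sub_const 1).abs
  | zero => simp [fejerMean]
  | add g₁ g₂ _ _ h₁ h₂ =>
    have i₁ := integrable_of_continuousMap_circle g₁
    have i₂ := integrable_of_continuousMap_circle g₂
    refine squeeze_zero (fun M => integral_nonneg fun t => norm_nonneg _) (fun M => ?_)
      (by simpa using h₁.add h₂)
    have j₁ := (integrable_fejerMean M i₁).sub i₁
    have j₂ := (integrable_fejerMean M i₂).sub i₂
    have e := integral_add j₁.norm j₂.norm
    simp only [Pi.sub_apply] at e
    rw [← e]
    refine integral_mono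
      ((integrable_fejerMean M (i₁.add i₂)).sub (i₁.add i₂)).norm (j₁.norm.add j₂.norm) fun t => ?_
    have := fejerMean_add M i₁ i₂ t
    simp only [ContinuousMap.coe_add, Pi.add_apply] at this ⊢
    rw [show (⇑g₁ + ⇑g₂ : UnitAddCircle → ℂ) = fun x => g₁ x + g₂ x from rfl, this,
      add_sub_add_comm]
    exact norm_add_le _ _
  | smul c g _ h =>
    have h' (M : ℕ) : ∫ t, ‖fejerMean M ⇑(c • g) t - (c • g) t‖ ∂haarAddCircle =
        ‖c‖ * ∫ t, ‖fejerMean M g t - g t‖ ∂haarAddCircle := by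
      rw [← integral_const_mul]
      congr with t
      rw [show ⇑(c • g) = fun x => c * g x from rfl, fejerMean_const_mul, ← mul_sub, norm_mul]
    simp_rw [h']
    simpa using h.const_mul ‖c‖

theorem exists_trigPolynomial_integral_norm_sub_lt {f : UnitAddCircle → ℂ}
    (hf : Integrable f haarAddCircle) {ε : ℝ} (hε : 0 < ε) :
    ∃ g ∈ Submodule.span ℂ (Set.range (fourier (T := 1))),
      ∫ t, ‖f t - g t‖ ∂haarAddCircle < ε := by
  have hmem := memLp_one_iff_integrable.2 hf
  have hdense : hmem.toLp ∈ (Submodule.span ℂ (Set.range (fourierLp 1))).topologicalClosure := by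
    rw [span_fourierLp_closure_eq_top (by simp)]
    trivial
  obtain ⟨G, hG, hGε⟩ := Metric.mem_closure_iff.1 hdense ε hε
  have hspan : Submodule.span ℂ (Set.range (fourierLp (T := 1) 1)) =
      (Submodule.span ℂ (Set.range (fourier (T := 1)))).map
        (ContinuousMap.toLp (E := ℂ) 1 haarAddCircle ℂ).toLinearMap := by
    rw [Submodule.map_span, ← Set.range_comp]
    rfl
  rw [hspan] at hG
  obtain ⟨g, hg, rfl⟩ := hG
  refine ⟨g, hg, ?_⟩
  rw [dist_eq_norm, L1.norm_eq_integral_norm] at hGε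
  refine lt_of_eq_of_lt (integral_congr_ae ?_) hGε
  filter_upwards [Lp.coeFn_sub hmem.toLp (ContinuousMap.toLp (E := ℂ) 1 haarAddCircle ℂ g),
    hmem.coeFn_toLp, ContinuousMap.coeFn_toLp (E := ℂ) (p := 1) (𝕜 := ℂ) haarAddCircle g]
    with x h1 h2 h3
  rw [← h2, ← h3]
  exact congrArg norm h1.symm

/-- **Fejér's theorem in `L¹`**: the Fejér means of an integrable function converge to it in
mean. By contractivity it suffices to check this on the dense span of the monomials `fourier n`,
where `fejerMean M` acts as multiplication by a factor tending to `1`. -/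
theorem tendsto_integral_norm_fejerMean_sub {f : UnitAddCircle → ℂ}
    (hf : Integrable f haarAddCircle) :
    Tendsto (fun M => ∫ t, ‖fejerMean M f t - f t‖ ∂haarAddCircle) atTop (𝓝 0) := by
  rw [Metric.tendsto_atTop]
  intro ε hε
  obtain ⟨g, hg, hfg⟩ := exists_trigPolynomial_integral_norm_sub_lt hf
    (show 0 < ε / 3 by positivity)
  obtain ⟨N, hN⟩ := Metric.tendsto_atTop.1 (tendsto_integral_fejerMean_sub_of_mem_span hg) (ε / 3)
    (by positivity)
  refine ⟨N, fun M hM => ?_⟩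
  have hgM := hN M hM
  have ig := integrable_of_continuousMap_circle g
  rw [Real.dist_eq, sub_zero, abs_of_nonneg (integral_nonneg fun t => norm_nonneg _)] at hgM ⊢
  have i₁ := (integrable_fejerMean M (hf.sub ig)).norm
  have i₂ := ((integrable_fejerMean M ig).sub ig).norm
  have i₃ := (hf.sub ig).norm
  have key : ∫ t, ‖fejerMean M f t - f t‖ ∂haarAddCircle ≤
      (∫ t, ‖fejerMean M (fun x => f x - g x) t‖ ∂haarAddCircle) +
      (∫ t, ‖fejerMean M g t - g t‖ ∂haarAddCircle) + ∫ t, ‖f t - g t‖ ∂haarAddCircle := by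
    have e₁ := integral_add i₁ i₂
    have e₂ := integral_add (i₁.add i₂) i₃
    simp only [Pi.add_apply] at e₁ e₂
    refine le_trans ?_ (e₂.trans (congrArg (· + _) e₁)).le
    refine integral_mono ((integrable_fejerMean M hf).sub hf).norm ((i₁.add i₂).add i₃) fun t => ?_
    have e := fejerMean_sub M hf ig t
    simp only [Pi.sub_apply]
    rw [show (f - ⇑g) = fun x => f x - g x from rfl, e]
    calc ‖fejerMean M f t - f t‖
        = ‖(fejerMean M f t - fejerMean M g t) + (fejerMean M g t - g t) - (f t - g t)‖ := by
          congr 1; ring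
      _ ≤ _ := (norm_sub_le _ _).trans (by gcongr; exact norm_add_le _ _)
  have hc := integral_norm_fejerMean_le M (hf.sub ig)
  simp only [Pi.sub_apply, show (f - ⇑g) = fun x => f x - g x from rfl] at hc
  linarith

/-! ### Berezin–Lieb inequalities and eigenvalues of Toeplitz matrices -/

theorem Matrix.IsHermitian.sum_star_mul_mul_eq_sum_eigenvalues {M : ℕ}
    {A : Matrix (Fin M) (Fin M) ℂ} (hA : A.IsHermitian) (v : EuclideanSpace ℂ (Fin M)) :
    ∑ m, ∑ p, star (v m) * v p * A m p =
      ((∑ m, hA.eigenvalues m * ‖inner ℂ (hA.eigenvectorBasis m) v‖ ^ 2 : ℝ) : ℂ) := by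
  have hsymm := Matrix.isSymmetric_toEuclideanLin_iff.2 hA
  have hev (m : Fin M) : A.toEuclideanLin (hA.eigenvectorBasis m) =
      (hA.eigenvalues m : ℂ) • hA.eigenvectorBasis m := by
    ext i
    have := congrFun (hA.mulVec_eigenvectorBasis m) i
    simpa [Matrix.toLpLin_apply] using this
  have h1 : ∑ m, ∑ p, star (v m) * v p * A m p = inner ℂ v (A.toEuclideanLin v) := by
    simp only [PiLp.inner_apply, RCLike.inner_apply, Matrix.toLpLin_apply, Matrix.mulVec,
      dotProduct, Finset.sum_mul]
    refine Finset.sum_congr rfl fun m _ => Finset.sum_congr rfl fun p _ => ?_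
    rw [RCLike.star_def]
    ring
  rw [h1, ← hA.eigenvectorBasis.sum_inner_mul_inner, Complex.ofReal_sum]
  refine Finset.sum_congr rfl fun m _ => ?_
  rw [← hsymm, hev, inner_smul_left, Complex.conj_ofReal, Complex.ofReal_mul, Complex.ofReal_pow,
    ← Complex.conj_mul', inner_conj_symm]
  ring

section

variable {f : UnitAddCircle → ℝ} {M : ℕ} {A : Matrix (Fin M) (Fin M) ℂ}

/-- Eigenvalues of a Toeplitz matrix are averages of its symbol, with weights given by the
corresponding eigenvectors. -/
theorem eigenvalues_eq_integral_of_toeplitz (hf : Integrable f haarAddCircle) (hA : A.IsHermitian)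
    (hAf : ∀ m p : Fin M, A m p = fourierCoeff (fun x => (f x : ℂ)) ((m : ℤ) - p)) (m : Fin M) :
    hA.eigenvalues m =
      ∫ x, ‖inner ℂ (hA.eigenvectorBasis m) (steeringVector M x)‖ ^ 2 * f x ∂haarAddCircle := by
  have hfc : Integrable (fun x => (f x : ℂ)) haarAddCircle := hf.ofReal
  have h := integral_norm_sq_inner_steeringVector_smul (hA.eigenvectorBasis m) hfc
  simp_rw [← hAf] at h
  rw [hA.sum_star_mul_mul_eq_sum_eigenvalues] at h
  simp only [Complex.real_smul, ← Complex.ofReal_mul] at h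
  rw [integral_complex_ofReal, Complex.ofReal_inj] at h
  rw [h, Finset.sum_eq_single m]
  · simp
  · intro p _ hp
    rw [hA.eigenvectorBasis.inner_eq_zero hp]
    simp
  · simp

theorem fejerMean_eq_sum_eigenvalues (hf : Integrable f haarAddCircle) (hA : A.IsHermitian)
    (hAf : ∀ m p : Fin M, A m p = fourierCoeff (fun x => (f x : ℂ)) ((m : ℤ) - p))
    (t : UnitAddCircle) :
    fejerMean M (fun x => (f x : ℂ)) t = (((∑ m, hA.eigenvalues m *
      ‖inner ℂ (hA.eigenvectorBasis m) (steeringVector M t)‖ ^ 2) / M : ℝ) : ℂ) := by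
  have hfc : Integrable (fun x => (f x : ℂ)) haarAddCircle := hf.ofReal
  rw [fejerMean_eq_sum M hfc]
  simp_rw [← hAf]
  rw [hA.sum_star_mul_mul_eq_sum_eigenvalues]
  push_cast
  rfl

/-- Upper **Berezin–Lieb inequality** for the convex function `x ↦ (c - x)⁺`. -/
theorem empiricalPrimitive_le_integral (hM : 0 < M) (hf : Integrable f haarAddCircle)
    (hA : A.IsHermitian)
    (hAf : ∀ m p : Fin M, A m p = fourierCoeff (fun x => (f x : ℂ)) ((m : ℤ) - p)) (c : ℝ) :
    empiricalPrimitive hA c ≤ ∫ x, max (c - f x) 0 ∂haarAddCircle := by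
  set w : Fin M → UnitAddCircle → ℝ :=
    fun m x => ‖inner ℂ (hA.eigenvectorBasis m) (steeringVector M x)‖ ^ 2 with hw
  have hw0 (m x) : 0 ≤ w m x := by positivity
  have hwi (m : Fin M) : ∫ x, w m x ∂haarAddCircle = 1 := by
    simp [hw, integral_norm_sq_inner_steeringVector]
  have hws (x) : ∑ m, w m x = M := by
    rw [hA.eigenvectorBasis.sum_sq_norm_inner_right, norm_sq_steeringVector]
  have hint {g : UnitAddCircle → ℝ} (hg : Integrable g haarAddCircle) (m : Fin M) :
      Integrable (fun x => w m x * g x) haarAddCircle :=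
    integrable_bdd_mul_circle (continuous_norm_sq_inner_steeringVector _) hg
  have hpos := integrable_posPart_sub hf c
  have hle (m : Fin M) : max (c - hA.eigenvalues m) 0 ≤
      ∫ x, w m x * max (c - f x) 0 ∂haarAddCircle := by
    refine max_le ?_ (integral_nonneg fun x => mul_nonneg (hw0 m x) (le_max_right _ _))
    have : c - hA.eigenvalues m = ∫ x, w m x * (c - f x) ∂haarAddCircle := by
      simp_rw [mul_sub]
      rw [integral_sub (hint (integrable_const c) m) (hint hf m), integral_mul_const, hwi, one_mul,
        ← eigenvalues_eq_integral_of_toeplitz hf hA hAf]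
    rw [this]
    exact integral_mono (hint ((integrable_const c).sub hf) m) (hint hpos m) fun x =>
      mul_le_mul_of_nonneg_left (le_max_left _ _) (hw0 m x)
  unfold empiricalPrimitive
  rw [div_le_iff₀ (Nat.cast_pos.2 hM)]
  refine (Finset.sum_le_sum fun m _ => hle m).trans_eq ?_
  rw [← integral_finsetSum _ fun m _ => hint hpos m, ← integral_mul_const]
  congr with x
  rw [← Finset.sum_mul, hws, mul_comm]

/-- Lower **Berezin–Lieb inequality** for the convex function `x ↦ (c - x)⁺`. -/
theorem integral_fejerMean_le_empiricalPrimitive (hM : 0 < M) (hf : Integrable f haarAddCircle)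
    (hA : A.IsHermitian)
    (hAf : ∀ m p : Fin M, A m p = fourierCoeff (fun x => (f x : ℂ)) ((m : ℤ) - p)) (c : ℝ) :
    ∫ t, max (c - (fejerMean M (fun x => (f x : ℂ)) t).re) 0 ∂haarAddCircle ≤
      empiricalPrimitive hA c := by
  set w : Fin M → UnitAddCircle → ℝ :=
    fun m x => ‖inner ℂ (hA.eigenvectorBasis m) (steeringVector M x)‖ ^ 2 with hw
  have hM' : (0 : ℝ) < M := Nat.cast_pos.2 hM
  have hw0 (m x) : 0 ≤ w m x := by positivity
  have hwi (m : Fin M) : ∫ x, w m x ∂haarAddCircle = 1 := by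
    simp [hw, integral_norm_sq_inner_steeringVector]
  have hws (x) : ∑ m, w m x = M := by
    rw [hA.eigenvectorBasis.sum_sq_norm_inner_right, norm_sq_steeringVector]
  have hint (m : Fin M) (a : ℝ) : Integrable (fun x => a * w m x) haarAddCircle :=
    (integrable_of_integral_eq_one (hwi m)).const_mul a
  have hpt (t : UnitAddCircle) : max (c - (fejerMean M (fun x => (f x : ℂ)) t).re) 0 ≤
      (∑ m, max (c - hA.eigenvalues m) 0 * w m t) / M := by
    refine max_le ?_ (div_nonneg (Finset.sum_nonneg fun m _ =>
      mul_nonneg (le_max_right _ _) (hw0 m t)) hM'.le)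
    rw [fejerMean_eq_sum_eigenvalues hf hA hAf, Complex.ofReal_re, le_div_iff₀ hM', sub_mul,
      div_mul_cancel₀ _ hM'.ne', ← hws t, Finset.mul_sum, ← Finset.sum_sub_distrib]
    refine Finset.sum_le_sum fun m _ => ?_
    rw [← sub_mul]
    exact mul_le_mul_of_nonneg_right (le_max_left _ _) (hw0 m t)
  refine (integral_mono (integrable_posPart_sub (integrable_fejerMean M hf.ofReal).re c)
    ((integrable_finsetSum _ fun m _ => hint m _).div_const _) hpt).trans_eq ?_
  rw [integral_div, integral_finsetSum _ fun m _ => hint m _]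
  simp_rw [integral_const_mul, hwi, mul_one]
  rfl

end

/-- **Szegő's theorem** for an integrable symbol, in integrated form: the empirical averages of
`(c - λ)⁺` over the eigenvalues of the Toeplitz matrices of `f` converge to `∫ (c - f)⁺`. -/
theorem tendsto_empiricalPrimitive_toeplitz {f : UnitAddCircle → ℝ}
    (hf : Integrable f haarAddCircle) {A : ∀ M : ℕ, Matrix (Fin M) (Fin M) ℂ}
    (hA : ∀ M, (A M).IsHermitian)
    (hAf : ∀ M, ∀ m p : Fin M,
      A M m p = fourierCoeff (fun x => (f x : ℂ)) ((m : ℤ) - p)) (c : ℝ) :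
    Tendsto (fun M => empiricalPrimitive (hA M) c) atTop
      (𝓝 (∫ x, max (c - f x) 0 ∂haarAddCircle)) := by
  have hlow : Tendsto (fun M => (∫ x, max (c - f x) 0 ∂haarAddCircle) -
      ∫ t, ‖fejerMean M (fun x => (f x : ℂ)) t - f t‖ ∂haarAddCircle) atTop
      (𝓝 (∫ x, max (c - f x) 0 ∂haarAddCircle)) := by
    simpa using tendsto_const_nhds.sub (tendsto_integral_norm_fejerMean_sub hf.ofReal)
  refine tendsto_of_tendsto_of_tendsto_of_le_of_le' hlow tendsto_const_nhds ?_ ?_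
  · filter_upwards [eventually_gt_atTop 0] with M hM
    refine le_trans ?_ (integral_fejerMean_le_empiricalPrimitive hM hf (hA M) (hAf M) c)
    have i₁ := integrable_posPart_sub hf c
    have i₂ : Integrable (fun t => ‖fejerMean M (fun x => (f x : ℂ)) t - f t‖) haarAddCircle :=
      ((integrable_fejerMean M hf.ofReal).sub hf.ofReal).norm
    rw [← integral_sub i₁ i₂]
    refine integral_mono (i₁.sub i₂)
      (integrable_posPart_sub (integrable_fejerMean M hf.ofReal).re c) fun t => ?_
    have h := (Complex.abs_re_le_norm (fejerMean M (fun x => (f x : ℂ)) t - f t))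
    rw [Complex.sub_re, Complex.ofReal_re, abs_le] at h
    change max (c - f t) 0 - ‖fejerMean M (fun x => (f x : ℂ)) t - f t‖ ≤
      max (c - (fejerMean M (fun x => (f x : ℂ)) t).re) 0
    rw [sub_le_iff_le_add]
    refine max_le ?_ (add_nonneg (le_max_right _ _) (norm_nonneg _))
    linarith [le_max_left (c - (fejerMean M (fun x => (f x : ℂ)) t).re) 0]
  · filter_upwards [eventually_gt_atTop 0] with M hM
    exact empiricalPrimitive_le_integral hM hf (hA M) (hAf M) c

/-! ### The angular spectrum of the array -/

theorem haarAddCircle_eq_volume : (haarAddCircle : Measure UnitAddCircle) = volume := by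
  rw [volume_eq_smul_haarAddCircle]; simp

theorem volume_coe_preimage_eq_zero {s : Set UnitAddCircle} (hs : MeasurableSet s)
    (h : volume s = 0) : volume (((↑) : ℝ → UnitAddCircle) ⁻¹' s) = 0 := by
  have hU : ((↑) : ℝ → UnitAddCircle) ⁻¹' s =
      ⋃ n : ℤ, ((↑) : ℝ → UnitAddCircle) ⁻¹' s ∩ Set.Ioc (n : ℝ) (n + 1) := by
    rw [← Set.inter_iUnion, iUnion_Ioc_intCast, Set.inter_univ]
  rw [hU, measure_iUnion_null_iff]
  intro n
  exact (add_projection_respects_measure 1 (n : ℝ) hs).symm.trans h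

/-- A closed ball of the circle is the projection of a closed interval. -/
theorem mem_closedBall_circle_iff {a b : ℝ} {x : UnitAddCircle} :
    x ∈ Metric.closedBall (((a + b) / 2 : ℝ) : UnitAddCircle) ((b - a) / 2) ↔
      ∃ u ∈ Set.Icc a b, (u : UnitAddCircle) = x := by
  rw [Metric.mem_closedBall, dist_eq_norm]
  constructor
  · induction x using QuotientAddGroup.induction_on with
    | H y =>
      intro h
      rw [← AddCircle.coe_sub, UnitAddCircle.norm_eq, abs_le] at h
      refine ⟨y - round (y - (a + b) / 2), ⟨by linarith [h.1], by linarith [h.2]⟩, ?_⟩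
      rw [AddCircle.coe_sub, sub_eq_self, AddCircle.coe_eq_zero_iff]
      exact ⟨round (y - (a + b) / 2), by simp⟩
  · rintro ⟨u, ⟨h₁, h₂⟩, rfl⟩
    rw [← AddCircle.coe_sub, UnitAddCircle.norm_eq]
    refine (round_le (u - (a + b) / 2) 0).trans ?_
    rw [Int.cast_zero, sub_zero, abs_le]
    constructor <;> linarith

/-- The (unnormalized) distribution on the circle of the spatial frequency `D sin α`, for `α`
uniform on the interval of angles of arrival. -/
noncomputable def angularMeasure (D θ Δ : ℝ) : Measure UnitAddCircle :=
  (volume.restrict (Set.Ioc (-Δ + θ) (Δ + θ))).map fun α => ((D * Real.sin α : ℝ) : UnitAddCircle)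

theorem measurable_spatialFrequency (D : ℝ) :
    Measurable fun α : ℝ => ((D * Real.sin α : ℝ) : UnitAddCircle) :=
  AddCircle.measurable_mk'.comp (Real.measurable_sin.const_mul D)

instance (D θ Δ : ℝ) : IsFiniteMeasure (angularMeasure D θ Δ) := by
  unfold angularMeasure; infer_instance

theorem angularMeasure_apply (D θ Δ : ℝ) {s : Set UnitAddCircle} (hs : MeasurableSet s) :
    angularMeasure D θ Δ s =
      volume ({α | ((D * Real.sin α : ℝ) : UnitAddCircle) ∈ s} ∩
        Set.Ioc (-Δ + θ) (Δ + θ)) := by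
  unfold angularMeasure
  rw [Measure.map_apply (measurable_spatialFrequency D) hs,
    Measure.restrict_apply (measurable_spatialFrequency D hs)]
  rfl

section

variable {D θ Δ : ℝ}

/-- The angular measure has a density, because `arcsin` is smooth inside its domain and thus maps
null sets to null sets. -/
theorem angularMeasure_absolutelyContinuous (hD : 0 < D)
    (hlo : -(Real.pi / 2) ≤ -Δ + θ) (hhi : Δ + θ ≤ Real.pi / 2) :
    angularMeasure D θ Δ ≪ haarAddCircle := by
  refine Measure.AbsolutelyContinuous.mk fun s hs h0 => ?_
  rw [haarAddCircle_eq_volume] at h0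
  rw [angularMeasure_apply D θ Δ hs]
  set N : Set ℝ := ((↑) : ℝ → UnitAddCircle) ⁻¹' s ∩ Set.Ioo (-D) D with hN
  have hN0 : volume N = 0 :=
    measure_mono_null Set.inter_subset_left (volume_coe_preimage_eq_zero hs h0)
  have hdiff : DifferentiableOn ℝ (fun u => Real.arcsin (u / D)) N := by
    rintro u ⟨-, hu₁, hu₂⟩
    have h₁ : -1 < u / D := (lt_div_iff₀ hD).2 (by simpa using hu₁)
    have h₂ : u / D < 1 := (div_lt_iff₀ hD).2 (by simpa using hu₂)
    exact ((Real.differentiableAt_arcsin.2 ⟨h₁.ne', h₂.ne⟩).comp u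
      (differentiableAt_id.div_const D)).differentiableWithinAt
  have himg := addHaar_image_eq_zero_of_differentiableOn_of_addHaar_eq_zero volume hdiff hN0
  refine measure_mono_null ?_ (measure_union_null himg (measure_singleton (Δ + θ)))
  rintro α ⟨hα, hα₁, hα₂⟩
  rcases hα₂.eq_or_lt with rfl | hα₃
  · exact Or.inr rfl
  left
  have h₁ : -(Real.pi / 2) < α := hlo.trans_lt hα₁
  have h₂ : α < Real.pi / 2 := hα₃.trans_le hhi
  have hs₁ : -1 < Real.sin α := by
    have := Real.sin_lt_sin_of_lt_of_le_pi_div_two le_rfl h₂.le h₁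
    rwa [Real.sin_neg, Real.sin_pi_div_two] at this
  have hs₂ : Real.sin α < 1 := by
    rw [← Real.sin_pi_div_two]
    exact Real.sin_lt_sin_of_lt_of_le_pi_div_two h₁.le le_rfl h₂
  refine ⟨D * Real.sin α, ⟨hα, by nlinarith, by nlinarith⟩, ?_⟩
  simp only
  rw [mul_div_cancel_left₀ _ hD.ne', Real.arcsin_sin h₁.le h₂.le]

/-- Conversely, since `sin` is smooth, the angular measure charges every non-null subset of the
arc swept by the spatial frequency. -/
theorem volume_eq_zero_of_angularMeasure_eq_zero (hΔ : -Δ + θ ≤ Δ + θ)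
    {s : Set UnitAddCircle} (hs : MeasurableSet s)
    (hsub : ∀ x ∈ s, ∃ u ∈ Set.Icc (D * Real.sin (-Δ + θ)) (D * Real.sin (Δ + θ)),
      (u : UnitAddCircle) = x)
    (h0 : angularMeasure D θ Δ s = 0) : volume s = 0 := by
  rw [angularMeasure_apply D θ Δ hs] at h0
  set I := Set.Icc (D * Real.sin (-Δ + θ)) (D * Real.sin (Δ + θ)) with hI
  have himg := addHaar_image_eq_zero_of_differentiableOn_of_addHaar_eq_zero volume
    (f := fun α => D * Real.sin α) (by fun_prop) h0
  have hN : volume (((↑) : ℝ → UnitAddCircle) ⁻¹' s ∩ I) = 0 := by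
    refine measure_mono_null ?_
      (measure_union_null himg (measure_singleton (D * Real.sin (-Δ + θ))))
    rintro u ⟨hu, huI⟩
    obtain ⟨α, hα, rfl⟩ := intermediate_value_Icc hΔ
      (f := fun α => D * Real.sin α) (by fun_prop) huI
    rcases hα.1.eq_or_lt with rfl | hα₁
    · exact Or.inr rfl
    · exact Or.inl ⟨α, ⟨hu, hα₁, hα.2⟩, rfl⟩
  rw [add_projection_respects_measure 1 0 hs]
  -- All real lifts of points of `s` are integer translates of lifts lying in `I`.
  have hcover : ((↑) : ℝ → UnitAddCircle) ⁻¹' s ⊆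
      ⋃ n : ℤ, (fun y : ℝ => y + n) ⁻¹' (((↑) : ℝ → UnitAddCircle) ⁻¹' s ∩ I) := by
    intro y hy
    obtain ⟨u, huI, hu⟩ := hsub y hy
    obtain ⟨n, hn⟩ := (AddCircle.coe_eq_zero_iff (1 : ℝ)).1
      (show ((u - y : ℝ) : UnitAddCircle) = 0 by rw [AddCircle.coe_sub, hu, sub_self])
    have hyn : y + n = u := by rw [zsmul_one] at hn; linarith
    refine Set.mem_iUnion.2 ⟨n, ?_⟩
    rw [Set.mem_preimage, hyn]
    exact ⟨by rw [Set.mem_preimage, hu]; exact hy, huI⟩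
  refine measure_mono_null Set.inter_subset_left (measure_mono_null hcover ?_)
  rw [measure_iUnion_null_iff]
  intro n
  rw [measure_preimage_add_right, hN]

/-- The angular spectrum: the density of the normalized angular measure with respect to Haar
measure on the circle. It is the symbol of the Toeplitz covariance matrices. -/
noncomputable def angularSpectrum (D θ Δ : ℝ) (x : UnitAddCircle) : ℝ :=
  (2 * Δ)⁻¹ * ((angularMeasure D θ Δ).rnDeriv haarAddCircle x).toReal

theorem measurable_angularSpectrum : Measurable (angularSpectrum D θ Δ) :=
  ((Measure.measurable_rnDeriv _ _).ennreal_toReal).const_mul _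

theorem integrable_angularSpectrum : Integrable (angularSpectrum D θ Δ) haarAddCircle :=
  Measure.integrable_toReal_rnDeriv.const_mul _

theorem ulaCovariance_apply_eq_fourierCoeff (hD : 0 < D) (hΔ : 0 < Δ)
    (hlo : -(Real.pi / 2) ≤ -Δ + θ) (hhi : Δ + θ ≤ Real.pi / 2) (M : ℕ) (m p : Fin M) :
    ulaCovariance D θ Δ M m p =
      fourierCoeff (fun x => (angularSpectrum D θ Δ x : ℂ)) ((m : ℤ) - p) := by
  have h1 : fourierCoeff (fun x => (angularSpectrum D θ Δ x : ℂ)) ((m : ℤ) - p) =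
      (1 / (2 * (Δ : ℂ))) * ∫ x, ((angularMeasure D θ Δ).rnDeriv haarAddCircle x).toReal •
        fourier (-((m : ℤ) - p)) x ∂haarAddCircle := by
    rw [← integral_const_mul]
    unfold fourierCoeff angularSpectrum
    congr with x
    rw [Complex.real_smul, smul_eq_mul]
    push_cast
    ring
  rw [h1, integral_rnDeriv_smul (angularMeasure_absolutelyContinuous hD hlo hhi)]
  unfold angularMeasure
  rw [integral_map (measurable_spatialFrequency D).aemeasurable
    (fourier (-((m : ℤ) - p))).continuous.aestronglyMeasurable, ulaCovariance, Matrix.of_apply,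
    intervalIntegral.integral_of_le (by linarith)]
  congr with α
  rw [fourier_coe_apply]
  congr 1
  push_cast
  ring

/-- The angular spectrum is supported, up to null sets, on the arc swept by the spatial
frequency. -/
theorem measureReal_angularSpectrum_ne_zero (hD : 0 < D) (hΔ : 0 < Δ)
    (hlo : -(Real.pi / 2) ≤ -Δ + θ) (hhi : Δ + θ ≤ Real.pi / 2) :
    haarAddCircle.real {x | angularSpectrum D θ Δ x ≠ 0} =
      min 1 (D * Real.sin (Δ + θ) - D * Real.sin (-Δ + θ)) := by
  set a := D * Real.sin (-Δ + θ) with ha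
  set b := D * Real.sin (Δ + θ) with hb
  set E : Set UnitAddCircle :=
    Metric.closedBall (((a + b) / 2 : ℝ) : UnitAddCircle) ((b - a) / 2) with hE
  have hac := angularMeasure_absolutelyContinuous hD hlo hhi
  set r := (angularMeasure D θ Δ).rnDeriv haarAddCircle with hr
  have hrm : Measurable r := Measure.measurable_rnDeriv _ _
  have hEm : MeasurableSet E := Metric.isClosed_closedBall.measurableSet
  have hab : a ≤ b := mul_le_mul_of_nonneg_left
    (Real.sin_le_sin_of_le_of_le_pi_div_two hlo hhi (by linarith)) hD.le
  -- Outside the arc, the measure and hence its density vanish.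
  have hout : ∀ᵐ x ∂haarAddCircle, x ∈ Eᶜ → r x = 0 := by
    have h0 : angularMeasure D θ Δ Eᶜ = 0 := by
      rw [angularMeasure_apply D θ Δ hEm.compl]
      convert measure_empty (μ := (volume : Measure ℝ))
      refine Set.eq_empty_of_forall_notMem ?_
      rintro α ⟨hα, hα₁, hα₂⟩
      refine hα (mem_closedBall_circle_iff.2 ⟨D * Real.sin α, ⟨?_, ?_⟩, rfl⟩)
      · exact mul_le_mul_of_nonneg_left
          (Real.sin_le_sin_of_le_of_le_pi_div_two hlo (hα₂.trans hhi) hα₁.le) hD.le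
      · exact mul_le_mul_of_nonneg_left
          (Real.sin_le_sin_of_le_of_le_pi_div_two (hlo.trans hα₁.le) hhi hα₂) hD.le
    rw [← Measure.setLIntegral_rnDeriv hac, lintegral_eq_zero_iff hrm] at h0
    exact (ae_restrict_iff' hEm.compl).1 h0
  -- The zero set of the density inside the arc has angular measure zero, hence is a null set.
  have hin : ∀ᵐ x ∂haarAddCircle, x ∈ E → r x ≠ 0 := by
    have hZ : MeasurableSet (E ∩ r ⁻¹' {0}) := hEm.inter (hrm (measurableSet_singleton 0))
    have h0 : angularMeasure D θ Δ (E ∩ r ⁻¹' {0}) = 0 := by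
      rw [← Measure.setLIntegral_rnDeriv hac]
      refine setLIntegral_eq_zero hZ fun x hx => hx.2
    have h1 := volume_eq_zero_of_angularMeasure_eq_zero (by linarith) hZ
      (fun x hx => mem_closedBall_circle_iff.1 hx.1) h0
    rw [haarAddCircle_eq_volume, ae_iff]
    convert h1 using 2
    ext x
    simp
  have hfin : ∀ᵐ x ∂haarAddCircle, r x < ⊤ := Measure.rnDeriv_lt_top _ _
  have hae : {x | angularSpectrum D θ Δ x ≠ 0} =ᵐ[haarAddCircle] E := by
    filter_upwards [hout, hin, hfin] with x h₁ h₂ h₃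
    refine propext ⟨fun hx => ?_, fun hx => ?_⟩
    · by_contra hxE
      refine hx ?_
      change (2 * Δ)⁻¹ * (r x).toReal = 0
      rw [h₁ hxE]
      simp
    · exact mul_ne_zero (by positivity) (ENNReal.toReal_ne_zero.2 ⟨h₂ hx, h₃.ne⟩)
  rw [measureReal_congr hae, haarAddCircle_eq_volume, measureReal_def, hE, volume_closedBall,
    mul_div_cancel₀ _ two_ne_zero, ENNReal.toReal_ofReal]
  exact le_min zero_le_one (sub_nonneg.2 hab)

end

/-! ### Colocated antennas -/

open scoped ComplexOrder in
/-- For `D = 0` the covariance matrix is the all-ones matrix, which is positive semidefinite of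
rank one, so almost all eigenvalues vanish in the limit. -/
theorem tendsto_empiricalPrimitive_ulaCovariance_zero (θ : ℝ) {Δ : ℝ} (hΔ : 0 < Δ) (c : ℝ) :
    Tendsto (fun M => empiricalPrimitive (ulaCovariance_isHermitian 0 θ Δ M) c) atTop
      (𝓝 (max c 0)) := by
  have hone (M : ℕ) : ulaCovariance 0 θ Δ M = Matrix.vecMulVec 1 (star 1) := by
    ext m p
    have : (Δ : ℂ) ≠ 0 := Complex.ofReal_ne_zero.2 hΔ.ne'
    simp only [ulaCovariance, Matrix.of_apply, Matrix.vecMulVec_apply, Complex.ofReal_zero,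
      mul_zero, zero_mul, Complex.exp_zero, intervalIntegral.integral_const]
    simp only [Complex.real_smul, Pi.one_apply, star_one]
    push_cast
    field_simp
    ring
  have hlow : Tendsto (fun M : ℕ => max c 0 - max c 0 / M) atTop (𝓝 (max c 0)) := by
    simpa using tendsto_const_nhds.sub (tendsto_const_div_atTop_nhds_zero_nat (max c 0))
  refine tendsto_of_tendsto_of_tendsto_of_le_of_le' hlow tendsto_const_nhds ?_ ?_
  · filter_upwards [eventually_gt_atTop 0] with M hM
    have hA := ulaCovariance_isHermitian 0 θ Δ M
    have hM' : (0 : ℝ) < M := Nat.cast_pos.2 hM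
    -- The at most one nonzero eigenvalue costs at most `max c 0` in the sum.
    have hrank : (Finset.univ.filter fun m => hA.eigenvalues m ≠ 0).card ≤ 1 := by
      rw [← Fintype.card_subtype, ← hA.rank_eq_card_non_zero_eigs, hone]
      exact Matrix.rank_vecMulVec_le _ _
    have hpt (m : Fin M) : max c 0 - (if hA.eigenvalues m ≠ 0 then max c 0 else 0) ≤
        max (c - hA.eigenvalues m) 0 := by
      split_ifs with h
      · rw [sub_self]; exact le_max_right _ _
      · rw [not_not.1 h, sub_zero, sub_zero]
    have hsum := Finset.sum_le_sum fun m (_ : m ∈ Finset.univ) => hpt m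
    rw [Finset.sum_sub_distrib, ← Finset.sum_filter, Finset.sum_const, Finset.sum_const,
      Finset.card_univ, Fintype.card_fin, nsmul_eq_mul, nsmul_eq_mul] at hsum
    unfold empiricalPrimitive
    rw [le_div_iff₀ hM', sub_mul, div_mul_cancel₀ _ hM'.ne']
    have : ((Finset.univ.filter fun m => hA.eigenvalues m ≠ 0).card : ℝ) * max c 0 ≤ max c 0 :=
      mul_le_of_le_one_left (le_max_right _ _) (by exact_mod_cast hrank)
    linarith
  · filter_upwards [eventually_gt_atTop 0] with M hM
    have hpsd : (ulaCovariance 0 θ Δ M).PosSemidef := by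
      rw [hone]; exact Matrix.posSemidef_vecMulVec_self_star _
    unfold empiricalPrimitive
    rw [div_le_iff₀ (Nat.cast_pos.2 hM)]
    refine (Finset.sum_le_sum fun m _ => max_le_max_right 0
      (sub_le_self c (hpsd.eigenvalues_nonneg m))).trans_eq ?_
    rw [Finset.sum_const, Finset.card_univ, Fintype.card_fin, nsmul_eq_mul, mul_comm]

/-! ### The asymptotic normalized rank -/

theorem theorem2 (D θ Δ : ℝ) (hD : 0 ≤ D) (hΔ : 0 < Δ)
    (hlo : -(Real.pi / 2) ≤ θ - Δ) (hhi : θ + Δ ≤ Real.pi / 2) :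
    HasAsymptoticNormalizedRank (ulaCovariance D θ Δ) (ulaCovariance_isHermitian D θ Δ)
      (min 1 |D * Real.sin (-Δ + θ) - D * Real.sin (Δ + θ)|) := by
  rw [sub_eq_neg_add] at hlo
  rw [add_comm] at hhi
  rcases hD.eq_or_lt with rfl | hD
  · have h := hasAsymptoticNormalizedRank_of_tendsto (μ := haarAddCircle (T := 1))
      (f := fun _ => 0) (integrable_zero _ _ _) measurable_const
      (ulaCovariance_isHermitian 0 θ Δ)
      (fun c => by simpa using tendsto_empiricalPrimitive_ulaCovariance_zero θ hΔ c)
    simpa using h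
  · have hsin : Real.sin (-Δ + θ) ≤ Real.sin (Δ + θ) :=
      Real.sin_le_sin_of_le_of_le_pi_div_two hlo hhi (by linarith)
    rw [abs_sub_comm, abs_of_nonneg (sub_nonneg.2 (mul_le_mul_of_nonneg_left hsin hD.le)),
      ← measureReal_angularSpectrum_ne_zero hD hΔ hlo hhi]
    exact hasAsymptoticNormalizedRank_of_tendsto integrable_angularSpectrum
      measurable_angularSpectrum _ (tendsto_empiricalPrimitive_toeplitz integrable_angularSpectrum _
        (ulaCovariance_apply_eq_fourierCoeff hD hΔ hlo hhi))
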